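/- **Conventions.** A Hausdorff space $X$ is a $k_\omega$-space if there are compact subsets $K_1\subseteq K_2\subseteq\cdots$ with $X=\bigcup_n K_n$ such that $U\subseteq X$ is open if and only if $U\cap K_n$ is open in $K_n$ for all $n$; $X$ is locally $k_\omega$ if it is Hausdorff and each point has an open neighbourhood which is a $k_\omega$-space in the induced topology. A topological group is called locally $k_\omega$ if its underlying space is so. Let $\mathbb T=\{z\in\mathbb C: |z|=1\}$. For a topological abelian group $G$, let $G^*$ be the group of continuous homomorphisms $G\to\mathbb T$ with the compact-open topology; for a continuous homomorphism $f\colon G\to H$ let $f^*\colon H^*\to G^*$, $f^*(\xi)=\xi\circ f$. The group $G$ is reflexive if $\eta_G\colon G\to G^{**}$, $\eta_G(x)(\xi)=\xi(x)$, is an isomorphism of topological groups. With $\mathbb T_+=\{z\in\mathbb T:\operatorname{Re} z\ge 0\}$, the polar of $A\subseteq G$ is $A^\circ=\{\xi\in G^*:\xi(A)\subseteq\mathbb T_+\}$, and that of $B\subseteq G^*$ is ${}^\circ B=\eta_G^{-1}(B^\circ)\subseteq G$. The group $G$ is locally quasi-convex if its identity element has a basis of neighbourhoods $U$ with $U={}^\circ(U^\circ)$.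 Let $\mathcal O_{\mathrm{lqc}}$ be the finest locally quasi-convex group topology on $G$ coarser than the given topology, let $G_{\mathrm{lqc}}$ be the quotient of $(G,\mathcal O_{\mathrm{lqc}})$ by the closure of its trivial subgroup, and let $\gamma\colon G\to G_{\mathrm{lqc}}$ be the canonical homomorphism. A subgroup $H$ of $G$ is dually embedded if each continuous homomorphism $H\to\mathbb T$ extends to a continuous homomorphism $G\to\mathbb T$. **Proposition.** Let $((G_n)_{n\in\mathbb N},(i_{n,m})_{n\ge m})$ be a direct sequence of abelian, locally $k_\omega$ groups and continuous homomorphisms $i_{n,m}\colon G_m\to G_n$, and let $(G,(i_n)_{n\in\mathbb N})$ be its direct limit in the category of Hausdorff abelian topological groups. (a) $(G^*,(i_n^*)_{n\in\mathbb N})$ is the projective limit of $((G_n^*)_{n\in\mathbb N},(i_{n,m}^*)_{n\ge m})$ as a topological group; that is, $\xi\mapsto(i_n^*(\xi))_{n}$ is an isomorphism of topological groups from $G^*$ onto the group of all $(\xi_n)_n\in\prod_n G_n^*$ such that $i_{n,m}^*(\xi_n)=\xi_m$ for all $n\ge m$, equipped with the topology induced by the product topology. (b) If each $G_n$ is reflexive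 and each $i_n^*\colon G^*\to G_n^*$ has dense image, then $G_{\mathrm{lqc}}$ is reflexive and $\gamma^*\colon (G_{\mathrm{lqc}})^*\to G^*$ is an isomorphism of topological groups. The condition that each $i_n^*$ has dense image is satisfied, for example, if $i_{n,m}$ is a topological embedding and $i_{n,m}(G_m)$ is dually embedded in $G_n$ for all $m\le n$. -/

import Mathlib

open Topology

universe u

/-! ### `k_ω`-spaces and locally `k_ω` spaces -/

/-- A Hausdorff space `X` is a `k_ω`-space if it is the direct limit, as a topological space, of an
ascending sequence of compact subsets covering it. -/
def IsKOmegaSpace (X : Type*) [TopologicalSpace X] : Prop :=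
  T2Space X ∧ ∃ K : ℕ → Set X, Monotone K ∧ (∀ n, IsCompact (K n)) ∧ (⋃ n, K n) = Set.univ ∧
    ∀ U : Set X, IsOpen U ↔ ∀ n, IsOpen ((↑) ⁻¹' U : Set (K n))

/-- A Hausdorff space is locally `k_ω` if each point has an open neighbourhood which is a
`k_ω`-space in the induced topology. -/
def IsLocallyKOmegaSpace (X : Type*) [TopologicalSpace X] : Prop :=
  T2Space X ∧ ∀ x : X, ∃ U : Set X, IsOpen U ∧ x ∈ U ∧ IsKOmegaSpace U

/-! ### Direct limits and projective limits -/

/-- `(G, (ι n))` is a direct limit of the direct sequence `(A, i)` in the category of Hausdorff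
abelian topological groups and continuous homomorphisms. -/
structure IsHausdorffDirectLimit {A : ℕ → Type u} [∀ n, CommGroup (A n)]
    [∀ n, TopologicalSpace (A n)] (i : ∀ m n, m ≤ n → (A m →ₜ* A n))
    (G : Type u) [CommGroup G] [TopologicalSpace G] (ι : ∀ n, A n →ₜ* G) : Prop where
  isTopologicalGroup : IsTopologicalGroup G
  t2Space : T2Space G
  comp_eq : ∀ m n (h : m ≤ n), (ι n).comp (i m n h) = ι m
  existsUnique_desc : ∀ (H : Type u) [CommGroup H] [TopologicalSpace H] [IsTopologicalGroup H]
    [T2Space H] (ψ : ∀ n, A n →ₜ* H), (∀ m n (h : m ≤ n), (ψ n).comp (i m n h) = ψ m) →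
    ∃! φ : G →ₜ* H, ∀ n, φ.comp (ι n) = ψ n

/-- The projective limit of a projective sequence `(B, p)` of abelian topological groups: the
group of compatible families, with the topology induced by the product topology. -/
def projectiveLimit (B : ℕ → Type*) [∀ n, CommGroup (B n)] [∀ n, TopologicalSpace (B n)]
    (p : ∀ m n, m ≤ n → (B n →ₜ* B m)) : Subgroup (∀ n, B n) where
  carrier := {b | ∀ m n (h : m ≤ n), p m n h (b n) = b m}
  one_mem' := fun m n h => by simp
  mul_mem' := fun {a b} ha hb m n h => by simp [ha m n h, hb m n h]
  inv_mem' := fun {a} ha m n h => by simp [ha m n h]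

/-! ### Pontryagin duality -/

section Duality

variable (G : Type*) [CommGroup G] [TopologicalSpace G]

/-- The evaluation homomorphism `η_G : G → G**`, `η_G(x)(ξ) = ξ(x)`. -/
noncomputable def dualEval : G →* PontryaginDual (PontryaginDual G) where
  toFun x :=
    { toFun := fun ξ => ξ x
      map_one' := rfl
      map_mul' := fun _ _ => rfl
      continuous_toFun :=
        (ContinuousEvalConst.continuous_eval_const x : Continuous fun ξ : G →ₜ* Circle => ξ x) }
  map_one' := by ext ξ; exact congrArg _ (map_one ξ)
  map_mul' x y := by ext ξ; exact congrArg _ (map_mul ξ x y)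

/-- `G` is reflexive if `η_G` is an isomorphism of topological groups (since `G**` is Hausdorff,
such a `G` is Hausdorff). -/
def IsReflexive : Prop := IsHomeomorph (dualEval G)

variable {G}

/-- The polar `A° = {ξ ∈ G* | ξ(A) ⊆ 𝕋₊}`, where `𝕋₊ = {z ∈ 𝕋 | 0 ≤ Re z}`. -/
def polar (A : Set G) : Set (PontryaginDual G) :=
  {ξ | ∀ x ∈ A, 0 ≤ (ξ x : ℂ).re}

/-- The polar `°B = η_G⁻¹(B°)` in `G` of a subset `B` of `G*`. -/
def prepolar (B : Set (PontryaginDual G)) : Set G := dualEval G ⁻¹' polar B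

theorem mem_prepolar_polar {A : Set G} {x : G} :
    x ∈ prepolar (polar A) ↔
      ∀ ξ : PontryaginDual G, (∀ a ∈ A, 0 ≤ (ξ a : ℂ).re) → 0 ≤ (ξ x : ℂ).re := Iff.rfl

theorem subset_prepolar_polar (A : Set G) : A ⊆ prepolar (polar A) :=
  fun x hx => mem_prepolar_polar.2 fun _ hξ => hξ x hx

theorem prepolar_polar_mono {A B : Set G} (h : A ⊆ B) :
    prepolar (polar A) ⊆ prepolar (polar B) :=
  fun _ hx ξ hξ => hx ξ fun a ha => hξ a (h ha)

theorem prepolar_polar_idem (A : Set G) :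
    prepolar (polar (prepolar (polar A))) = prepolar (polar A) :=
  (Set.Subset.antisymm (subset_prepolar_polar _)
    fun _ hx => mem_prepolar_polar.2 fun ξ hξ => hx ξ fun _ ha => ha ξ hξ).symm

/-- A subgroup `H` of `G` is dually embedded if each character of `H` extends to `G`. -/
def IsDuallyEmbedded (H : Subgroup G) : Prop :=
  ∀ ξ : PontryaginDual H, ∃ θ : PontryaginDual G, ∀ x : H, θ x = ξ x

variable (G)

/-- `G` is locally quasi-convex if the neighbourhoods `U` of the neutral element with
`U = °(U°)` form a basis of neighbourhoods of it. -/
def IsLocallyQuasiConvex : Prop :=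
  (𝓝 (1 : G)).HasBasis (fun U => U ∈ 𝓝 (1 : G) ∧ U = prepolar (polar U)) id

theorem isLocallyQuasiConvex_iff :
    IsLocallyQuasiConvex G ↔ ∀ W ∈ 𝓝 (1 : G), ∃ U ∈ 𝓝 (1 : G), prepolar (polar U) ⊆ W := by
  constructor
  · intro h W hW
    obtain ⟨U, ⟨hU, hUU⟩, hUW⟩ := h.mem_iff.1 hW
    exact ⟨U, hU, hUU ▸ hUW⟩
  · refine fun h => ⟨fun W => ⟨fun hW => ?_, ?_⟩⟩
    · obtain ⟨U, hU, hUW⟩ := h W hW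
      exact ⟨_, ⟨Filter.mem_of_superset hU (subset_prepolar_polar U),
        (prepolar_polar_idem U).symm⟩, hUW⟩
    · rintro ⟨U, ⟨hU, -⟩, hUW⟩
      exact Filter.mem_of_superset hU hUW

end Duality

/-! ### The locally quasi-convex group associated with a topological abelian group -/

/-- The topology `𝒪_lqc`: the finest locally quasi-convex group topology on `G` which is coarser
than the given topology `t`. (For topologies, `t ≤ s` means that `s` is coarser than `t`, and the
infimum is the topology generated by all members; that it has the properties required of the
members is `lqcTopology_mem`.) -/
@[reducible] def lqcTopology (G : Type*) [CommGroup G] [t : TopologicalSpace G] : TopologicalSpace G :=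
  sInf {s | t ≤ s ∧ @IsTopologicalGroup G s _ ∧ @IsLocallyQuasiConvex G _ s}

theorem lqcTopology_mem (G : Type*) [CommGroup G] [t : TopologicalSpace G] :
    lqcTopology G ∈
      {s | t ≤ s ∧ @IsTopologicalGroup G s _ ∧ @IsLocallyQuasiConvex G _ s} := by
  refine ⟨le_sInf fun s hs => hs.1, topologicalGroup_sInf fun s hs => hs.2.1, ?_⟩
  rw [@isLocallyQuasiConvex_iff G _ (@lqcTopology G _ t)]
  intro W hW
  have hn : @nhds G (@lqcTopology G _ t) 1 = _ := nhds_sInf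
  rw [iInf_subtype'] at hn
  rw [hn] at hW ⊢
  refine Filter.iInf_sets_induct hW ⟨Set.univ, Filter.univ_mem, Set.subset_univ _⟩ ?_
  rintro ⟨s, hs⟩ W₁ W₂ hW₁ ⟨U₂, hU₂, hUW₂⟩
  obtain ⟨U₁, hU₁, hUW₁⟩ := (@isLocallyQuasiConvex_iff G _ s).1 hs.2.2 W₁ hW₁
  refine ⟨U₁ ∩ U₂, Filter.inter_mem (Filter.mem_iInf_of_mem ⟨s, hs⟩ hU₁) hU₂,
    Set.subset_inter (fun x hx => hUW₁ ?_) fun x hx => hUW₂ ?_⟩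
  · intro ξ hξ
    let ξ' : @PontryaginDual G _ (@lqcTopology G _ t) :=
      @ContinuousMonoidHom.mk G Circle _ _ (@lqcTopology G _ t) _
        (@ContinuousMonoidHom.toMonoidHom G Circle _ _ s _ ξ)
        (continuous_le_dom (show @lqcTopology G _ t ≤ s from sInf_le hs)
          (@ContinuousMonoidHom.continuous_toFun G Circle _ _ s _ ξ))
    exact hx ξ' fun a ha => hξ a ha.1
  · exact fun ξ hξ => hx ξ fun a ha => hξ a ha.2

/-- The group `G`, equipped with the topology `𝒪_lqc`. -/
def WithLqcTopology (G : Type*) : Type _ := G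

section Lqc

variable (G : Type*) [CommGroup G] [TopologicalSpace G]

instance : CommGroup (WithLqcTopology G) := inferInstanceAs (CommGroup G)

instance : TopologicalSpace (WithLqcTopology G) := lqcTopology G

instance : IsTopologicalGroup (WithLqcTopology G) := (lqcTopology_mem G).2.1

/-- `G_lqc`, the quotient of `(G, 𝒪_lqc)` by the closure of the trivial subgroup. -/
abbrev Lqc : Type _ :=
  WithLqcTopology G ⧸ (⊥ : Subgroup (WithLqcTopology G)).topologicalClosure

/-- The canonical homomorphism `γ : G → G_lqc`. -/
def toLqc : G →ₜ* Lqc G where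
  toFun x := QuotientGroup.mk (s := (⊥ : Subgroup (WithLqcTopology G)).topologicalClosure) x
  map_one' := rfl
  map_mul' _ _ := rfl
  continuous_toFun :=
    (QuotientGroup.continuous_mk (N := (⊥ : Subgroup (WithLqcTopology G)).topologicalClosure)).comp
      (continuous_id_iff_le.2 (lqcTopology_mem G).1)

end Lqc

/-! Exhaustions of neighbourhoods of `1` in the groups `A n` combine into one for the final topology
on the direct limit `G`. Products of exhaustions are exhaustions, so multiplication is continuous
and the final topology is a group topology; by the universal property it is the topology of `G`.
Hence each compact subset of `G` is the image of a compact subset of some `A n`, so that the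
compact-open topology on the dual of `G` is the one induced by the duals of the `A n`.

A character of the dual of `G` has positive real part on a preimage of the polar of a compact
subset of some `A n`, so if the dual of `ι n` has dense range, it comes from a character of the dual
of `A n`, which is evaluation at a point when `A n` is reflexive. Hence `η_G` is surjective. It is
continuous, as is `η_{G*}`, because `G` and its dual have the final topology with respect to their
compact subsets. As `𝒪_lqc` is the topology induced by `η_G`, the group `G_lqc` is isomorphic to
`G**`, and `η_{G*}` is a continuous inverse of the dual of `η_G`. -/

/-! ### Characters and the right half of the circle -/

theorem continuous_circle_re : Continuous fun z : Circle => (z : ℂ).re :=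
  Complex.continuous_re.comp continuous_subtype_val

theorem circle_re_sq (z : Circle) : ((z ^ 2 : Circle) : ℂ).re = 2 * (z : ℂ).re ^ 2 - 1 := by
  have h := Circle.normSq_coe z
  rw [Complex.normSq_apply] at h
  rw [Circle.coe_pow, pow_two, Complex.mul_re]
  linarith

theorem circle_dist_one_sq (z : Circle) : dist z 1 ^ 2 = 2 * (1 - (z : ℂ).re) := by
  have h := Circle.normSq_coe z
  rw [Complex.normSq_apply] at h
  have hdist : dist z 1 = ‖(z : ℂ) - (1 : Circle)‖ := Complex.dist_eq _ _
  rw [hdist, ← Complex.normSq_eq_norm_sq, Complex.normSq_apply]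
  simp only [Complex.sub_re, Complex.sub_im, Circle.coe_one, Complex.one_re, Complex.one_im]
  linarith

theorem circle_one_sub_re_le (m : ℕ) :
    ∀ z : Circle, (∀ j ≤ m, 0 ≤ ((z ^ 2 ^ j : Circle) : ℂ).re) →
      1 - (z : ℂ).re ≤ (1 / 2) ^ m := by
  induction m with
  | zero => exact fun z hz => by simpa using hz 0 le_rfl
  | succ m ih =>
    intro z hz
    have hre : 0 ≤ (z : ℂ).re := by simpa using hz 0 (Nat.zero_le _)
    have hsq : 1 - ((z ^ 2 : Circle) : ℂ).re ≤ (1 / 2) ^ m := ih _ fun j hj => by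
      rw [← pow_mul, ← pow_succ']
      exact hz (j + 1) (Nat.succ_le_succ hj)
    rw [circle_re_sq] at hsq
    have hle : (z : ℂ).re ≤ 1 := by nlinarith [sq_nonneg (dist z 1), circle_dist_one_sq z]
    -- `1 - Re z² = 2 (1 + Re z) (1 - Re z) ≥ 2 (1 - Re z)`
    rw [pow_succ]
    nlinarith

theorem exists_forall_circle_pow_imp_mem {W : Set Circle} (hW : W ∈ 𝓝 1) :
    ∃ m : ℕ, ∀ z : Circle, (∀ j ≤ m, 0 ≤ ((z ^ 2 ^ j : Circle) : ℂ).re) → z ∈ W := by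
  obtain ⟨ε, hε, hεW⟩ := Metric.mem_nhds_iff.1 hW
  obtain ⟨m, hm⟩ := exists_pow_lt_of_lt_one (show 0 < ε ^ 2 / 2 by positivity)
    (show (1 / 2 : ℝ) < 1 by norm_num)
  refine ⟨m, fun z hz => hεW ?_⟩
  have hdist : dist z 1 ^ 2 < ε ^ 2 := by
    linarith [circle_dist_one_sq z, circle_one_sub_re_le m z hz]
  exact Metric.mem_ball.2 (lt_of_pow_lt_pow_left₀ 2 hε.le hdist)

theorem exists_mem_nhds_one_forall_hom_mem {M : Type*} [CommMonoid M] [TopologicalSpace M]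
    [ContinuousMul M] {U : Set M} (hU : U ∈ 𝓝 1) {W : Set Circle} (hW : W ∈ 𝓝 1) :
    ∃ V ∈ 𝓝 (1 : M), ∀ χ : M →* Circle, (∀ x ∈ U, 0 ≤ (χ x : ℂ).re) → ∀ x ∈ V, χ x ∈ W := by
  obtain ⟨m, hm⟩ := exists_forall_circle_pow_imp_mem hW
  have hpow : ∀ᶠ x in 𝓝 (1 : M), ∀ j ∈ Finset.range (m + 1), x ^ 2 ^ j ∈ U := by
    rw [Filter.eventually_all_finset]
    exact fun j _ => (continuous_pow (2 ^ j)).continuousAt.eventually_mem (by simpa using hU)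
  refine ⟨_, hpow, fun χ hχ x hx => hm _ fun j hj => ?_⟩
  rw [← map_pow]
  exact hχ _ (hx j (Finset.mem_range_succ_iff.2 hj))

/-! ### Polars -/

section Polar

variable {G H : Type*} [CommGroup G] [TopologicalSpace G] [CommGroup H] [TopologicalSpace H]

theorem isInducing_toContinuousMap :
    IsInducing fun ξ : PontryaginDual G => (ξ : C(G, Circle)) :=
  ContinuousMonoidHom.isInducing_toContinuousMap G Circle

theorem isClosed_polar (A : Set G) : IsClosed (polar A) := by
  simp only [polar, Set.ofPred_forall]
  exact isClosed_biInter fun x _ => isClosed_le continuous_const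
    (continuous_circle_re.comp (map_continuous (dualEval G x)))

theorem polar_anti {A B : Set G} (h : A ⊆ B) : polar B ⊆ polar A :=
  fun _ hξ x hx => hξ x (h hx)

theorem polar_image (f : G →ₜ* H) (A : Set G) :
    polar (f '' A) = PontryaginDual.map f ⁻¹' polar A :=
  Set.ext fun _ => Set.forall_mem_image

theorem setOf_mapsTo_mem_nhds_one {K : Set G} (hK : IsCompact K) {W : Set Circle}
    (hW : W ∈ 𝓝 1) : {ξ : PontryaginDual G | Set.MapsTo ξ K W} ∈ 𝓝 1 := by
  have hopen : IsOpen {f : C(G, Circle) | Set.MapsTo f K (interior W)} :=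
    ContinuousMap.isOpen_setOfPred_mapsTo hK isOpen_interior
  exact Filter.mem_of_superset
    ((hopen.preimage isInducing_toContinuousMap.continuous).mem_nhds
      fun _ _ => mem_interior_iff_mem_nhds.2 hW)
    fun _ hξ => Set.MapsTo.mono_right hξ interior_subset

theorem setOf_forall_re_pos_mem_nhds_one {K : Set G} (hK : IsCompact K) :
    {ξ : PontryaginDual G | ∀ x ∈ K, 0 < (ξ x : ℂ).re} ∈ 𝓝 1 :=
  setOf_mapsTo_mem_nhds_one hK <|
    (isOpen_lt continuous_const continuous_circle_re).mem_nhds (by simp)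

theorem polar_mem_nhds_one {K : Set G} (hK : IsCompact K) :
    polar K ∈ 𝓝 (1 : PontryaginDual G) :=
  Filter.mem_of_superset (setOf_forall_re_pos_mem_nhds_one hK) fun _ hξ x hx => (hξ x hx).le

theorem exists_isCompact_polar_subset_setOf_mapsTo [ContinuousMul G] {K : Set G}
    (hK : IsCompact K) {W : Set Circle} (hW : W ∈ 𝓝 1) :
    ∃ C : Set G, IsCompact C ∧ polar C ⊆ {ξ | Set.MapsTo ξ K W} := by
  obtain ⟨m, hm⟩ := exists_forall_circle_pow_imp_mem hW
  refine ⟨⋃ j ∈ Finset.range (m + 1), (fun x => x ^ 2 ^ j) '' K,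
    Finset.isCompact_biUnion _ fun j _ => hK.image (continuous_pow _), fun ξ hξ x hx =>
    hm _ fun j hj => ?_⟩
  rw [← map_pow]
  exact hξ _ (Set.mem_biUnion (Finset.mem_range_succ_iff.2 hj) (Set.mem_image_of_mem _ hx))

theorem exists_isCompact_polar_subset [ContinuousMul G] {W : Set (PontryaginDual G)}
    (hW : W ∈ 𝓝 1) : ∃ K : Set G, IsCompact K ∧ polar K ⊆ W := by
  rw [isInducing_toContinuousMap.nhds_eq_comap] at hW
  obtain ⟨V, hV, hVW⟩ := hW
  obtain ⟨S, hS, hSo, hSV⟩ := ContinuousMap.mem_nhds_iff.1 hV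
  have hpolar : ∀ p ∈ S, ∃ C : Set G, IsCompact C ∧ polar C ⊆ {ξ | Set.MapsTo ξ p.1 p.2} := by
    rintro ⟨K, U⟩ hp
    obtain ⟨hK, hU, h1⟩ := hSo K U hp
    rcases K.eq_empty_or_nonempty with rfl | ⟨x, hx⟩
    · exact ⟨∅, isCompact_empty, fun ξ _ => Set.mapsTo_empty _ _⟩
    · exact exists_isCompact_polar_subset_setOf_mapsTo hK (hU.mem_nhds (h1 hx))
  choose! C hC hCS using hpolar
  refine ⟨⋃ p ∈ S, C p, hS.isCompact_biUnion hC, fun ξ hξ => hVW (hSV fun K U hp => ?_)⟩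
  exact hCS _ hp (polar_anti (Set.subset_biUnion_of_mem hp) hξ)

theorem hasBasis_nhds_one_polar [ContinuousMul G] :
    (𝓝 (1 : PontryaginDual G)).HasBasis (fun K : Set G => IsCompact K) polar :=
  ⟨fun _ => ⟨exists_isCompact_polar_subset, fun ⟨_, hK, hKW⟩ =>
    Filter.mem_of_superset (polar_mem_nhds_one hK) hKW⟩⟩

theorem equicontinuous_of_forall_mem_re_nonneg [IsTopologicalGroup G] {U : Set G} (hU : U ∈ 𝓝 1) :
    Equicontinuous fun χ : {χ : G →* Circle | ∀ x ∈ U, 0 ≤ (χ x : ℂ).re} => (χ : G → Circle) := by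
  refine equicontinuous_of_equicontinuousAt_one _ ?_
  rw [(Filter.basis_sets _).uniformity_of_nhds_one.equicontinuousAt_iff_right]
  intro W hW
  obtain ⟨V, hV, hVW⟩ := exists_mem_nhds_one_forall_hom_mem hU hW
  filter_upwards [hV] with x hx χ
  change (χ : G →* Circle) x / (χ : G →* Circle) 1 ∈ W
  rw [map_one, div_one]
  exact hVW χ χ.2 x hx

theorem image_coe_polar [IsTopologicalGroup G] {U : Set G} (hU : U ∈ 𝓝 1) :
    (DFunLike.coe : PontryaginDual G → G → Circle) '' polar U =
      Set.range (DFunLike.coe : (G →* Circle) → G → Circle) ∩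
        ⋂ x ∈ U, {f | 0 ≤ (f x : ℂ).re} := by
  ext f
  simp only [Set.mem_inter_iff, Set.mem_iInter]
  constructor
  · rintro ⟨ξ, hξ, rfl⟩
    exact ⟨⟨ContinuousMonoidHom.toMonoidHom ξ, rfl⟩, hξ⟩
  · rintro ⟨⟨χ, rfl⟩, hχ⟩
    have hcont : Continuous χ := (equicontinuous_of_forall_mem_re_nonneg hU).continuous ⟨χ, hχ⟩
    exact ⟨(⟨χ, hcont⟩ : G →ₜ* Circle), hχ, rfl⟩

theorem isCompact_polar [IsTopologicalGroup G] {U : Set G} (hU : U ∈ 𝓝 1) :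
    IsCompact (polar U) := by
  rw [isInducing_toContinuousMap.isCompact_iff]
  refine ArzelaAscoli.isCompact_of_equicontinuous _ ?_ ?_
  · rw [Set.image_image]
    refine (image_coe_polar hU ▸ ?_ : IsCompact ((DFunLike.coe : PontryaginDual G → _) '' polar U))
    exact ((MonoidHom.isClosed_range_coe G Circle).inter (isClosed_biInter fun x _ =>
      isClosed_le continuous_const (continuous_circle_re.comp (continuous_apply x)))).isCompact
  · have hhom : ∀ f : (fun ξ : PontryaginDual G => (ξ : C(G, Circle))) '' polar U,
        ∃ χ : {χ : G →* Circle | ∀ x ∈ U, 0 ≤ (χ x : ℂ).re},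
          ((χ : G →* Circle) : G → Circle) = (f : C(G, Circle)) := by
      rintro ⟨-, ξ, hξ, rfl⟩
      exact ⟨⟨ContinuousMonoidHom.toMonoidHom ξ, hξ⟩, rfl⟩
    choose χ hχ using hhom
    simpa only [Function.comp_def, hχ] using
      (equicontinuous_of_forall_mem_re_nonneg hU).comp χ

theorem isOpen_setOf_forall_re_pos {K : Set G} [CompactSpace K] {L : Set (PontryaginDual G)}
    (hL : IsCompact L) : IsOpen {x : K | ∀ ξ ∈ L, 0 < (ξ x : ℂ).re} := by
  have := isCompact_iff_compactSpace.1 hL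
  have hrestrict : Continuous fun ξ : L => (ξ.1 : C(G, Circle)).restrict K :=
    (ContinuousMap.continuous_restrict K).comp
      (isInducing_toContinuousMap.continuous.comp continuous_subtype_val)
  have heval : Continuous fun p : L × K => (((p.1 : PontryaginDual G) p.2 : Circle) : ℂ).re :=
    continuous_circle_re.comp
      (continuous_eval.comp ((hrestrict.comp continuous_fst).prodMk continuous_snd))
  have hclosed : IsClosed {p : L × K | (((p.1 : PontryaginDual G) p.2 : Circle) : ℂ).re ≤ 0} :=
    isClosed_le heval continuous_const
  convert (isClosedMap_snd_of_compactSpace _ hclosed).isOpen_compl using 1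
  ext x
  simp

end Polar

/-! ### Groups whose topology is determined by compact sets -/

theorem compactlyCoherentSpace_of_mem_nhds_one {G : Type*} [Group G] [TopologicalSpace G]
    [SeparatelyContinuousMul G]
    (h : ∀ S : Set G, 1 ∈ S → (∀ K : Set G, IsCompact K → IsOpen ((↑) ⁻¹' S : Set K)) → S ∈ 𝓝 1) :
    CompactlyCoherentSpace G := by
  refine .of_isOpen fun S hS => isOpen_iff_mem_nhds.2 fun x hx => ?_
  have htranslate : (x * ·) ⁻¹' S ∈ 𝓝 1 := by
    refine h _ (by simpa using hx) fun K hK => ?_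
    have hcont : Continuous fun y : K => (⟨x * y, y, y.2, rfl⟩ : (x * ·) '' K) := by fun_prop
    exact (hS _ (hK.image (continuous_const_mul x))).preimage hcont
  have hmap : Filter.map (x * ·) (𝓝 1) = 𝓝 x := by
    simpa only [Homeomorph.coe_mulLeft, mul_one] using (Homeomorph.mulLeft x).map_nhds_eq 1
  exact hmap ▸ htranslate

theorem continuous_dualEval {G : Type*} [CommGroup G] [TopologicalSpace G] [IsTopologicalGroup G]
    [CompactlyCoherentSpace G] : Continuous (dualEval G) := by
  refine continuous_of_continuousAt_one _ ?_
  rw [ContinuousAt, map_one]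
  refine hasBasis_nhds_one_polar.tendsto_right_iff.2 fun L hL => ?_
  have hopen : IsOpen {x : G | ∀ ξ ∈ L, 0 < (ξ x : ℂ).re} :=
    CompactlyCoherentSpace.isOpen_iff.2 fun K hK =>
      have := isCompact_iff_compactSpace.1 hK
      isOpen_setOf_forall_re_pos hL
  filter_upwards [hopen.mem_nhds fun ξ _ => by simp] with x hx ξ hξ using (hx ξ hξ).le

/-- The ascending sequence `B` of compact sets exhausts an open neighbourhood of `x` which is the
direct limit of these sets as a topological space. Unlike in the definition of a locally `k_ω`
space, nothing is required away from `x`, and the space need not be Hausdorff. -/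
structure IsKOmegaExhaustionAt {X : Type*} [TopologicalSpace X] (x : X) (B : ℕ → Set X) :
    Prop where
  monotone : Monotone B
  isCompact : ∀ n, IsCompact (B n)
  mem : ∀ n, x ∈ B n
  isOpen : ∀ O ⊆ ⋃ n, B n, (∀ n, IsOpen ((↑) ⁻¹' O : Set (B n))) → IsOpen O

theorem IsLocallyKOmegaSpace.exists_isKOmegaExhaustionAt {X : Type*} [TopologicalSpace X]
    (h : IsLocallyKOmegaSpace X) (x : X) : ∃ B : ℕ → Set X, IsKOmegaExhaustionAt x B := by
  obtain ⟨U, hU, hxU, -, K, hKm, hKc, hKU, hK⟩ := h.2 x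
  obtain ⟨n₀, hn₀⟩ : ∃ n₀, (⟨x, hxU⟩ : U) ∈ K n₀ := Set.mem_iUnion.1 (hKU ▸ Set.mem_univ _)
  refine ⟨fun n => (↑) '' K (n₀ + n),
    fun m n hmn => Set.image_mono (hKm (Nat.add_le_add_left hmn n₀)),
    fun n => (hKc _).image continuous_subtype_val,
    fun n => ⟨_, hKm (Nat.le_add_right n₀ n) hn₀, rfl⟩, fun O hO hOK => ?_⟩
  have hOU : O ⊆ U := hO.trans (Set.iUnion_subset fun n => Subtype.coe_image_subset _ _)
  have hOopen : IsOpen ((↑) ⁻¹' O : Set U) := by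
    refine (hK _).2 fun n => ?_
    have hcont : Continuous fun y : K n =>
        (⟨y, y, hKm (Nat.le_add_left n n₀) y.2, rfl⟩ : ((↑) : U → X) '' K (n₀ + n)) := by
      fun_prop
    exact (hOK n).preimage hcont
  simpa [Set.inter_eq_right.2 hOU] using hU.isOpenMap_subtype_val _ hOopen

namespace IsKOmegaExhaustionAt

section Topology

variable {X : Type*} [TopologicalSpace X] {x : X} {B : ℕ → Set X}

theorem eventually_of_forall_isOpen (hB : IsKOmegaExhaustionAt x B) {p : X → Prop} (hx : p x)
    (hp : ∀ n, IsOpen {y : B n | p y}) : ∀ᶠ y in 𝓝 x, y ∈ ⋃ n, B n ∧ p y := by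
  refine (hB.isOpen {y | y ∈ ⋃ n, B n ∧ p y} (fun y hy => hy.1) fun n => ?_).mem_nhds
    ⟨Set.mem_iUnion_of_mem 0 (hB.mem 0), hx⟩
  convert hp n using 1
  ext y
  exact and_iff_right (Set.mem_iUnion_of_mem n y.2)

theorem iUnion_mem_nhds (hB : IsKOmegaExhaustionAt x B) : (⋃ n, B n) ∈ 𝓝 x :=
  (hB.eventually_of_forall_isOpen (p := fun _ => True) trivial fun _ => isOpen_univ).mono
    fun _ => And.left

theorem monotone_of_forall_mem_nhdsWithin (hB : IsKOmegaExhaustionAt x B) {Q : ℕ → Set X}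
    (hQB : ∀ n, Q n ⊆ B n) (hQ : ∀ n, ∀ y ∈ Q n, Q (n + 1) ∈ 𝓝[B (n + 1)] y) : Monotone Q :=
  monotone_nat_of_le_succ fun n y hy =>
    mem_of_mem_nhdsWithin (hB.monotone n.le_succ (hQB n hy)) (hQ n y hy)

theorem iUnion_mem_nhds_of_forall_mem_nhdsWithin (hB : IsKOmegaExhaustionAt x B) {Q : ℕ → Set X}
    (hQx : x ∈ Q 0) (hQB : ∀ n, Q n ⊆ B n)
    (hQ : ∀ n, ∀ y ∈ Q n, Q (n + 1) ∈ 𝓝[B (n + 1)] y) : (⋃ n, Q n) ∈ 𝓝 x := by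
  refine (hB.eventually_of_forall_isOpen (Set.mem_iUnion_of_mem 0 hQx) fun m =>
    isOpen_iff_mem_nhds.2 fun y hy => ?_).mono fun _ => And.right
  obtain ⟨k, hk⟩ := Set.mem_iUnion.1 hy
  have hnhds : Q (max k m + 1) ∈ 𝓝[B m] (y : X) :=
    nhdsWithin_mono _ (hB.monotone (by omega))
      (hQ _ _ (hB.monotone_of_forall_mem_nhdsWithin hQB hQ (le_max_left k m) hk))
  exact preimage_coe_mem_nhds_subtype.2 (Filter.mem_of_superset hnhds (Set.subset_iUnion Q _))

theorem exists_subset_of_isCompact [T1Space X] (hB : IsKOmegaExhaustionAt x B) {K : Set X}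
    (hK : IsCompact K) (hKB : K ⊆ ⋃ n, B n) : ∃ n, K ⊆ B n := by
  by_contra! h
  simp only [Set.not_subset] at h
  choose y hyK hyB using h
  -- Only finitely many `y n` lie in each `B m`, so every set of `y n` is relatively closed.
  let O (k : ℕ) : Set X := (⋃ m, B m) \ y '' Set.Ici k
  have hO : ∀ k, IsOpen (O k) := fun k => hB.isOpen _ Set.sdiff_subset fun m => by
    have hfinite : (y '' Set.Ici k ∩ B m).Finite := by
      refine ((Set.finite_Iio m).image y).subset ?_
      rintro - ⟨⟨n, -, rfl⟩, hn⟩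
      exact ⟨n, lt_of_not_ge fun hmn => hyB n (hB.monotone hmn hn), rfl⟩
    convert hfinite.isClosed.isOpen_compl.preimage continuous_subtype_val using 1
    ext z
    simp only [Set.mem_preimage, Set.mem_compl_iff, Set.mem_inter_iff, z.2, and_true, O,
      Set.mem_sdiff, Set.mem_iUnion_of_mem m z.2, true_and]
  have hOmono : Monotone O := fun k l hkl =>
    Set.sdiff_subset_sdiff_right (Set.image_mono (Set.Ici_subset_Ici.2 hkl))
  have hKO : K ⊆ ⋃ k, O k := fun z hz => by
    obtain ⟨m, hm⟩ := Set.mem_iUnion.1 (hKB hz)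
    refine Set.mem_iUnion.2 ⟨m, hKB hz, ?_⟩
    rintro ⟨n, hmn, rfl⟩
    exact hyB n (hB.monotone hmn hm)
  obtain ⟨k, hk⟩ := hK.elim_directed_cover O hO hKO hOmono.directed_le
  exact (hk (hyK k)).2 ⟨k, Set.self_mem_Ici, rfl⟩

end Topology

section Group

theorem compactlyCoherentSpace {G : Type*} [Group G] [TopologicalSpace G]
    [SeparatelyContinuousMul G] {B : ℕ → Set G} (hB : IsKOmegaExhaustionAt 1 B) :
    CompactlyCoherentSpace G :=
  compactlyCoherentSpace_of_mem_nhds_one fun _ h1 hS =>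
    (hB.eventually_of_forall_isOpen h1 fun n => hS _ (hB.isCompact n)).mono fun _ => And.right

variable {G : Type*} [CommGroup G] [TopologicalSpace G] {B : ℕ → Set G}

theorem exists_mem_nhds_one_forall_mem_polar (hB : IsKOmegaExhaustionAt 1 B)
    {ξ : ℕ → PontryaginDual G} (hξ : ∀ n, ∀ x ∈ B n, 0 < (ξ n x : ℂ).re) :
    ∃ V ∈ 𝓝 (1 : G), ∀ n, ξ n ∈ polar V := by
  have hpos : ∀ᶠ x in 𝓝 (1 : G), x ∈ ⋃ n, B n ∧ ∀ n, 0 < (ξ n x : ℂ).re := by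
    refine hB.eventually_of_forall_isOpen (fun n => by simp) fun m => ?_
    -- On `B m` only the finitely many conditions with `n < m` are not automatic.
    have hopen : IsOpen (⋂ n ∈ Finset.range m, {x : B m | 0 < (ξ n x : ℂ).re}) :=
      isOpen_biInter_finset fun n _ => isOpen_lt continuous_const
        (continuous_circle_re.comp ((map_continuous (ξ n)).comp continuous_subtype_val))
    convert hopen using 1
    ext x
    simp only [Set.mem_iInter, Finset.mem_range]
    exact ⟨fun h n _ => h n, fun h n =>
      (lt_or_ge n m).elim (h n) fun hmn => hξ n x (hB.monotone hmn x.2)⟩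
  exact ⟨_, hpos, fun n x hx => (hx.2 n).le⟩

variable [IsTopologicalGroup G]

theorem exists_mapClusterPt_mem_polar (hB : IsKOmegaExhaustionAt 1 B)
    {ξ : ℕ → PontryaginDual G} (hξ : ∀ n, ∀ x ∈ B n, 0 < (ξ n x : ℂ).re) :
    ∃ P : Set (PontryaginDual G), IsCompact P ∧ (∀ n, ξ n ∈ P) ∧
      ∃ θ ∈ P ∩ polar (⋃ n, B n), MapClusterPt θ Filter.atTop ξ := by
  obtain ⟨V, hV, hξV⟩ := hB.exists_mem_nhds_one_forall_mem_polar hξ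
  obtain ⟨θ, hθV, hθ⟩ := (isCompact_polar hV).exists_mapClusterPt (f := Filter.atTop) (u := ξ)
    (Filter.tendsto_principal.2 (Filter.Eventually.of_forall hξV))
  refine ⟨_, isCompact_polar hV, hξV, θ, ⟨hθV, fun x hx => ?_⟩, hθ⟩
  obtain ⟨m, hm⟩ := Set.mem_iUnion.1 hx
  have hmem : ∀ᶠ n in Filter.atTop, ξ n ∈ polar (B m) :=
    (Filter.eventually_ge_atTop m).mono fun n hn y hy => (hξ n y (hB.monotone hn hy)).le
  exact (isClosed_polar (B m)).mem_of_mapClusterPt hθ hmem x hm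

theorem compactlyCoherentSpace_pontryaginDual (hB : IsKOmegaExhaustionAt 1 B) :
    CompactlyCoherentSpace (PontryaginDual G) := by
  refine compactlyCoherentSpace_of_mem_nhds_one fun S h1 hS => ?_
  have hnhds : ∀ P, IsCompact P → ∀ θ ∈ P, θ ∈ S → S ∈ 𝓝[P] θ := fun P hP θ hθ hθS =>
    preimage_coe_mem_nhds_subtype (a := ⟨θ, hθ⟩).1 ((hS P hP).mem_nhds hθS)
  obtain ⟨W, hW, hWS⟩ := mem_nhdsWithin_iff_exists_mem_nhds_inter.1
    (hnhds _ (isCompact_polar hB.iUnion_mem_nhds) 1 (fun x _ => by simp) h1)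
  obtain ⟨F, ⟨hF, hFclosed⟩, hFW⟩ := (closed_nhds_basis (1 : PontryaginDual G)).mem_iff.1 hW
  by_contra hcon
  have hexists : ∀ n, ∃ ξ : PontryaginDual G, (∀ x ∈ B n, 0 < (ξ x : ℂ).re) ∧ ξ ∈ F ∧ ξ ∉ S := by
    intro n
    by_contra! h
    exact hcon (Filter.mem_of_superset
      (Filter.inter_mem (setOf_forall_re_pos_mem_nhds_one (hB.isCompact n)) hF)
      fun ξ hξ => h ξ hξ.1 hξ.2)
  choose ξ hξB hξF hξS using hexists
  obtain ⟨P, hP, hξP, θ, ⟨hθP, hθB⟩, hθ⟩ := hB.exists_mapClusterPt_mem_polar hξB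
  have hθF : θ ∈ F := hFclosed.mem_of_mapClusterPt hθ (Filter.Eventually.of_forall hξF)
  obtain ⟨N, hN, hNS⟩ := mem_nhdsWithin_iff_exists_mem_nhds_inter.1
    (hnhds P hP θ hθP (hWS ⟨hFW hθF, hθB⟩))
  obtain ⟨n, hn⟩ := (hθ.frequently hN).exists
  exact hξS n (hNS ⟨hn, hξP n⟩)

end Group

end IsKOmegaExhaustionAt

/-! ### Duality and the locally quasi-convex modification -/

section Modification

variable {G H : Type*} [CommGroup G] [CommGroup H] [TopologicalSpace H]

theorem isLocallyQuasiConvex_pontryaginDual [ContinuousMul H] :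
    IsLocallyQuasiConvex (PontryaginDual H) := by
  refine (isLocallyQuasiConvex_iff _).2 fun W hW => ?_
  obtain ⟨K, hK, hKW⟩ := exists_isCompact_polar_subset hW
  refine ⟨polar K, polar_mem_nhds_one hK, fun ξ hξ => hKW fun x hx => ?_⟩
  exact hξ (dualEval H x) fun χ hχ => hχ x hx

theorem isLocallyQuasiConvex_induced (f : G →* H) (hH : IsLocallyQuasiConvex H) :
    @IsLocallyQuasiConvex G _ (.induced f inferInstance) := by
  let := TopologicalSpace.induced f inferInstance
  have hf : IsInducing f := ⟨rfl⟩
  refine (isLocallyQuasiConvex_iff G).2 fun W hW => ?_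
  rw [hf.nhds_eq_comap, map_one] at hW
  obtain ⟨V, hV, hVW⟩ := hW
  obtain ⟨U, hU, hUV⟩ := (isLocallyQuasiConvex_iff H).1 hH V hV
  refine ⟨f ⁻¹' U, hf.continuous.continuousAt (by rwa [map_one]), fun x hx => hVW (hUV ?_)⟩
  exact fun ξ hξ => hx (ξ.comp ⟨f, hf.continuous⟩) fun a ha => hξ (f a) ha

variable [TopologicalSpace G]

variable (G) in
/-- The identity, as a continuous homomorphism from `G` to `(G, 𝒪_lqc)`. -/
def toWithLqcTopology : G →ₜ* WithLqcTopology G where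
  toFun x := x
  map_one' := rfl
  map_mul' _ _ := rfl
  continuous_toFun := continuous_id_iff_le.2 (lqcTopology_mem G).1

/-- A continuous homomorphism `f` to a locally quasi-convex group, regarded as a continuous
homomorphism on `(G, 𝒪_lqc)`. -/
def WithLqcTopology.lift [IsTopologicalGroup H] (f : G →ₜ* H) (hH : IsLocallyQuasiConvex H) :
    WithLqcTopology G →ₜ* H where
  toMonoidHom := (f : G →* H)
  continuous_toFun := continuous_iff_le_induced.2 <| sInf_le
    ⟨continuous_iff_le_induced.1 (map_continuous f), topologicalGroup_induced (f : G →* H),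
      isLocallyQuasiConvex_induced (f : G →* H) hH⟩

/-- The continuous homomorphism on `G_lqc` induced by a continuous homomorphism from `G` to a
Hausdorff locally quasi-convex group. -/
def Lqc.lift [IsTopologicalGroup H] [T1Space H] (f : G →ₜ* H) (hH : IsLocallyQuasiConvex H) :
    Lqc G →ₜ* H where
  toMonoidHom := QuotientGroup.lift _ (WithLqcTopology.lift f hH : WithLqcTopology G →* H) <|
    Subgroup.topologicalClosure_minimal _ bot_le
      (isClosed_singleton.preimage (map_continuous (WithLqcTopology.lift f hH)))
  continuous_toFun := (map_continuous (WithLqcTopology.lift f hH)).quotient_lift _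

theorem Lqc.isHomeomorph_lift [IsTopologicalGroup H] [T1Space H] {f : G →ₜ* H}
    {hH : IsLocallyQuasiConvex H} (hf : IsInducing (WithLqcTopology.lift f hH))
    (hsurj : Function.Surjective f) : IsHomeomorph (Lqc.lift f hH) := by
  have hopen : IsOpenMap (WithLqcTopology.lift f hH) :=
    hf.isOpenMap (hsurj.range_eq ▸ isOpen_univ)
  refine ⟨map_continuous _, fun O hO => ?_, ?_, fun y => ?_⟩
  · rw [← Set.image_preimage_eq O QuotientGroup.mk_surjective, ← Set.image_comp]
    exact hopen _ (hO.preimage QuotientGroup.continuous_mk)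
  · have hker : (⊥ : Subgroup (WithLqcTopology G)).topologicalClosure ≤
        (WithLqcTopology.lift f hH : WithLqcTopology G →* H).ker :=
      Subgroup.topologicalClosure_minimal _ bot_le (isClosed_singleton.preimage hf.continuous)
    refine (QuotientGroup.injective_lift_iff _ _ hker).2 (le_antisymm hker fun x hx => ?_)
    change x ∈ closure _
    rw [hf.closure_eq_preimage_closure_image]
    exact subset_closure ⟨1, rfl, (map_one _).trans hx.symm⟩
  · obtain ⟨x, rfl⟩ := hsurj y
    exact ⟨toLqc G x, rfl⟩

theorem isHomeomorph_pontryaginDual_map {f : G →ₜ* H} (hf : IsHomeomorph f) :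
    IsHomeomorph (PontryaginDual.map f) := by
  let g : H →ₜ* G :=
    ⟨(MulEquiv.ofBijective (f : G →* H) hf.bijective).symm, hf.homeomorph.symm.continuous⟩
  refine isHomeomorph_iff_exists_inverse.2 ⟨map_continuous _, PontryaginDual.map g,
    fun ξ => ?_, fun ξ => ?_, map_continuous _⟩
  · ext x : 1
    exact congrArg ξ (hf.homeomorph.apply_symm_apply x)
  · ext x : 1
    exact congrArg ξ (hf.homeomorph.symm_apply_apply x)

/-- The evaluation homomorphism `η_G`, bundled with a proof of its continuity. -/
noncomputable def dualEvalHom (hη : Continuous (dualEval G)) :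
    G →ₜ* PontryaginDual (PontryaginDual G) := ⟨dualEval G, hη⟩

theorem isHomeomorph_map_dualEvalHom (hη : Continuous (dualEval G))
    (hη' : Continuous (dualEval (PontryaginDual G))) (hsurj : Function.Surjective (dualEval G)) :
    IsHomeomorph (PontryaginDual.map (dualEvalHom hη)) := by
  refine isHomeomorph_iff_exists_inverse.2 ⟨map_continuous _, dualEval (PontryaginDual G),
    fun χ => ?_, fun ξ => rfl, hη'⟩
  ext p : 1
  obtain ⟨x, rfl⟩ := hsurj p
  rfl

variable [IsTopologicalGroup G]

theorem isInducing_lift_dualEvalHom (hη : Continuous (dualEval G)) :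
    IsInducing (WithLqcTopology.lift (dualEvalHom hη) isLocallyQuasiConvex_pontryaginDual) := by
  refine IsTopologicalGroup.isInducing_iff_nhds_one.2 (le_antisymm ?_ fun W hW => ?_)
  · refine Filter.tendsto_iff_comap.1 (ContinuousAt.tendsto ?_ |>.trans_eq (by rw [map_one]))
    exact (map_continuous _).continuousAt
  · obtain ⟨U, hU, hUW⟩ :=
      (isLocallyQuasiConvex_iff (WithLqcTopology G)).1 (lqcTopology_mem G).2.2 W hW
    have hU' : toWithLqcTopology G ⁻¹' U ∈ 𝓝 (1 : G) :=
      (map_continuous (toWithLqcTopology G)).continuousAt (by rwa [map_one])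
    refine ⟨_, polar_mem_nhds_one (isCompact_polar hU'), fun x hx => hUW fun ξ hξ => ?_⟩
    exact hx (PontryaginDual.map (toWithLqcTopology G) ξ) hξ

theorem isReflexive_lqc_and_isHomeomorph_map_toLqc (hη : Continuous (dualEval G))
    (hη' : Continuous (dualEval (PontryaginDual G))) (hsurj : Function.Surjective (dualEval G)) :
    IsReflexive (Lqc G) ∧ IsHomeomorph (PontryaginDual.map (toLqc G)) := by
  let E : Lqc G →ₜ* PontryaginDual (PontryaginDual G) :=
    Lqc.lift (dualEvalHom hη) isLocallyQuasiConvex_pontryaginDual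
  have hE : IsHomeomorph E := Lqc.isHomeomorph_lift (isInducing_lift_dualEvalHom hη) hsurj
  let e := (isHomeomorph_pontryaginDual_map hE).homeomorph
  have hγ : IsHomeomorph (PontryaginDual.map (toLqc G)) := by
    have hcomp : PontryaginDual.map (toLqc G) ∘ e = PontryaginDual.map (dualEvalHom hη) := rfl
    rw [← Function.comp_id (PontryaginDual.map (toLqc G)), ← e.self_comp_symm,
      ← Function.comp_assoc, hcomp]
    exact (isHomeomorph_map_dualEvalHom hη hη' hsurj).comp e.symm.isHomeomorph
  have hcomp : dualEval (Lqc G) = PontryaginDual.map (PontryaginDual.map (toLqc G)) ∘ E := by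
    funext y
    obtain ⟨x, rfl⟩ := QuotientGroup.mk_surjective y
    rfl
  refine ⟨?_, hγ⟩
  rw [IsReflexive, hcomp]
  exact (isHomeomorph_pontryaginDual_map hγ).comp hE

end Modification

/-! ### Products of exhaustions -/

section Product

variable {X Y Z : Type*} [TopologicalSpace X] [TopologicalSpace Y] [TopologicalSpace Z]

theorem exists_isCompact_subset_image_forall_mem_nhdsWithin [R1Space X] {B Q : Set X}
    (hB : IsCompact B) (hQ : IsCompact Q) (hQB : Q ⊆ B) {U : Set B} (hU : IsOpen U)
    (hQU : (↑) ⁻¹' Q ⊆ U) :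
    ∃ L : Set X, IsCompact L ∧ L ⊆ (↑) '' U ∧ ∀ x ∈ Q, L ∈ 𝓝[B] x := by
  have := isCompact_iff_compactSpace.1 hB
  have hQ' : IsCompact ((↑) ⁻¹' Q : Set B) :=
    (IsInducing.subtypeVal.isCompact_preimage_iff (by simpa using hQB)).2 hQ
  obtain ⟨L, hL, hQL, hLU⟩ := exists_compact_between hQ' hU hQU
  refine ⟨(↑) '' L, hL.image continuous_subtype_val, Set.image_mono hLU, fun x hx => ?_⟩
  refine (mem_nhds_subtype_iff_nhdsWithin (a := ⟨x, hQB hx⟩)).1 ?_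
  exact mem_interior_iff_mem_nhds.1 (hQL hx)

theorem exists_isCompact_prod_subset_forall_mem_nhdsWithin [R1Space X] [R1Space Y]
    {B Q : Set X} {C R : Set Y} {O : Set (X × Y)} (hB : IsCompact B) (hC : IsCompact C)
    (hQ : IsCompact Q) (hR : IsCompact R) (hQB : Q ⊆ B) (hRC : R ⊆ C)
    (hO : IsOpen ((↑) ⁻¹' O : Set (B ×ˢ C : Set (X × Y)))) (hQR : Q ×ˢ R ⊆ O) :
    ∃ Q' : Set X, ∃ R' : Set Y, (IsCompact Q' ∧ IsCompact R' ∧ Q' ⊆ B ∧ R' ⊆ C ∧ Q' ×ˢ R' ⊆ O) ∧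
      (∀ x ∈ Q, Q' ∈ 𝓝[B] x) ∧ ∀ y ∈ R, R' ∈ 𝓝[C] y := by
  have hO' : IsOpen {p : B × C | ((p.1 : X), (p.2 : Y)) ∈ O} := by
    have hcont : Continuous fun p : B × C =>
        (⟨(p.1, p.2), p.1.2, p.2.2⟩ : (B ×ˢ C : Set (X × Y))) := by fun_prop
    exact hO.preimage hcont
  have hQ' : IsCompact ((↑) ⁻¹' Q : Set B) :=
    (IsInducing.subtypeVal.isCompact_preimage_iff (by simpa using hQB)).2 hQ
  have hR' : IsCompact ((↑) ⁻¹' R : Set C) :=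
    (IsInducing.subtypeVal.isCompact_preimage_iff (by simpa using hRC)).2 hR
  obtain ⟨U, V, hU, hV, hQU, hRV, hUV⟩ :=
    generalized_tube_lemma hQ' hR' hO' fun p hp => hQR ⟨hp.1, hp.2⟩
  obtain ⟨L, hL, hLU, hLQ⟩ :=
    exists_isCompact_subset_image_forall_mem_nhdsWithin hB hQ hQB hU hQU
  obtain ⟨M, hM, hMV, hMR⟩ :=
    exists_isCompact_subset_image_forall_mem_nhdsWithin hC hR hRC hV hRV
  refine ⟨L, M, ⟨hL, hM, hLU.trans (Subtype.coe_image_subset _ _),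
    hMV.trans (Subtype.coe_image_subset _ _), ?_⟩, hLQ, hMR⟩
  rintro ⟨x, y⟩ ⟨hx, hy⟩
  obtain ⟨a, ha, rfl⟩ := hLU hx
  obtain ⟨b, hb, rfl⟩ := hMV hy
  exact hUV (Set.mk_mem_prod ha hb)

theorem continuousOn_of_injective_of_isCompact [T2Space Z] {f : Y → Z} (hf : Continuous f)
    (hinj : Function.Injective f) {g : X → Y} {S : Set X} {T : Set Y} (hT : IsCompact T)
    (hg : Set.MapsTo g S T) (hfg : ContinuousOn (f ∘ g) S) : ContinuousOn g S := by
  have := isCompact_iff_compactSpace.1 hT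
  have hemb : IsClosedEmbedding (T.domRestrict f) :=
    (hf.comp continuous_subtype_val).isClosedEmbedding (hinj.comp Subtype.val_injective)
  rw [continuousOn_iff_continuous_domRestrict] at hfg ⊢
  exact continuous_subtype_val.comp (hemb.continuous_iff.2 hfg : Continuous (hg.restrict g S T))

namespace IsKOmegaExhaustionAt

variable {x : X} {y : Y} {B : ℕ → Set X} {C : ℕ → Set Y}

theorem continuousAt (hB : IsKOmegaExhaustionAt x B) {f : X → Y}
    (hf : ∀ n, ContinuousOn f (B n)) : ContinuousAt f x := fun W hW => by
  obtain ⟨O, hOW, hO, hxO⟩ := mem_nhds_iff.1 hW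
  exact (hB.eventually_of_forall_isOpen (p := (f · ∈ O)) hxO fun n =>
    hO.preimage (hf n).domRestrict).mono fun y hy => hOW hy.2

theorem nat_add (hB : IsKOmegaExhaustionAt x B) {x' : X} {k : ℕ} (hx' : x' ∈ B k) :
    IsKOmegaExhaustionAt x' fun n => B (k + n) where
  monotone _ _ h := hB.monotone (Nat.add_le_add_left h k)
  isCompact n := hB.isCompact (k + n)
  mem n := hB.monotone (Nat.le_add_right k n) hx'
  isOpen O hO hOB := by
    refine hB.isOpen O (hO.trans (Set.iUnion_subset fun n => Set.subset_iUnion B _)) fun n => ?_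
    exact (hOB n).preimage (continuous_inclusion (hB.monotone (Nat.le_add_left n k)))

theorem mem_nhds_prod_of_forall_isOpen [R1Space X] [R1Space Y] (hB : IsKOmegaExhaustionAt x B)
    (hC : IsKOmegaExhaustionAt y C) {O : Set (X × Y)} (hxy : (x, y) ∈ O)
    (hO : ∀ n, IsOpen ((↑) ⁻¹' O : Set (B n ×ˢ C n : Set (X × Y)))) : O ∈ 𝓝 (x, y) := by
  let IsBox (n : ℕ) (Q : Set X × Set Y) : Prop :=
    IsCompact Q.1 ∧ IsCompact Q.2 ∧ Q.1 ⊆ B n ∧ Q.2 ⊆ C n ∧ Q.1 ×ˢ Q.2 ⊆ O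
  have hstep : ∀ n Q, IsBox n Q → ∃ Q', IsBox (n + 1) Q' ∧
      (∀ a ∈ Q.1, Q'.1 ∈ 𝓝[B (n + 1)] a) ∧ ∀ b ∈ Q.2, Q'.2 ∈ 𝓝[C (n + 1)] b := by
    rintro n ⟨Q, R⟩ ⟨hQ, hR, hQB, hRC, hQR⟩
    obtain ⟨Q', R', h⟩ := exists_isCompact_prod_subset_forall_mem_nhdsWithin
      (hB.isCompact (n + 1)) (hC.isCompact (n + 1)) hQ hR (hQB.trans (hB.monotone n.le_succ))
      (hRC.trans (hC.monotone n.le_succ)) (hO (n + 1)) hQR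
    exact ⟨(Q', R'), h⟩
  choose! next hnext hnextB hnextC using hstep
  let Q (n : ℕ) : Set X × Set Y := Nat.rec ({x}, {y}) next n
  have hQ : ∀ n, IsBox n (Q n) := Nat.rec
    ⟨isCompact_singleton, isCompact_singleton, Set.singleton_subset_iff.2 (hB.mem 0),
      Set.singleton_subset_iff.2 (hC.mem 0), by simpa [Q] using hxy⟩ fun n ih => hnext n _ ih
  have hQB n := hnextB n _ (hQ n)
  have hQC n := hnextC n _ (hQ n)
  refine Filter.mem_of_superset (prod_mem_nhds
    (hB.iUnion_mem_nhds_of_forall_mem_nhdsWithin rfl (fun n => (hQ n).2.2.1) hQB)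
    (hC.iUnion_mem_nhds_of_forall_mem_nhdsWithin rfl (fun n => (hQ n).2.2.2.1) hQC)) ?_
  rintro ⟨a, b⟩ ⟨ha, hb⟩
  obtain ⟨k, hk⟩ := Set.mem_iUnion.1 ha
  obtain ⟨l, hl⟩ := Set.mem_iUnion.1 hb
  exact (hQ (max k l)).2.2.2.2
    ⟨hB.monotone_of_forall_mem_nhdsWithin (fun n => (hQ n).2.2.1) hQB (le_max_left k l) hk,
      hC.monotone_of_forall_mem_nhdsWithin (fun n => (hQ n).2.2.2.1) hQC (le_max_right k l) hl⟩

theorem prod [R1Space X] [R1Space Y] (hB : IsKOmegaExhaustionAt x B)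
    (hC : IsKOmegaExhaustionAt y C) : IsKOmegaExhaustionAt (x, y) fun n => B n ×ˢ C n where
  monotone _ _ h := Set.prod_mono (hB.monotone h) (hC.monotone h)
  isCompact n := (hB.isCompact n).prod (hC.isCompact n)
  mem n := ⟨hB.mem n, hC.mem n⟩
  isOpen O hO hOBC := isOpen_iff_mem_nhds.2 fun p hp => by
    obtain ⟨k, hk⟩ := Set.mem_iUnion.1 (hO hp)
    exact (hB.nat_add hk.1).mem_nhds_prod_of_forall_isOpen (hC.nat_add hk.2) hp fun n =>
      hOBC (k + n)

end IsKOmegaExhaustionAt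

end Product

/-! ### Direct sequences and the final topology -/

open scoped Pointwise

section DirectSequence

variable {A : ℕ → Type*} [∀ n, CommGroup (A n)] [∀ n, TopologicalSpace (A n)]
  {i : ∀ m n, m ≤ n → (A m →ₜ* A n)}

section Limit

variable {X : Type*} [CommGroup X] [TopologicalSpace X] {ι : ∀ n, A n →ₜ* X}
  {K : ∀ n, ℕ → Set (A n)}

theorem exists_isCompact_image_eq (hι : ∀ m n (h : m ≤ n) (a : A m), ι n (i m n h a) = ι m a)
    {m n : ℕ} (h : m ≤ n) {C : Set (A m)} (hC : IsCompact C) :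
    ∃ C' : Set (A n), IsCompact C' ∧ ι n '' C' = ι m '' C := by
  refine ⟨i m n h '' C, hC.image (map_continuous _), ?_⟩
  rw [Set.image_image]
  exact Set.image_congr fun a _ => hι m n h a

variable (ι K) in
/-- The ascending sequence of subsets of the limit `X` of a direct sequence `A` which is obtained
from exhaustions `K n` of the groups `A n` at `1`: it exhausts a neighbourhood of `1` in `X`. The
products are included so that the union is open: it contains the translates by the images of the
`K n` of each of its points. -/
def limitExhaustion : ℕ → Set X
  | 0 => {1}
  | n + 1 => limitExhaustion n * limitExhaustion n ∪ ⋃ k ∈ Finset.range (n + 1), ι k '' K k n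

theorem one_mem_limitExhaustion : ∀ n, 1 ∈ limitExhaustion ι K n
  | 0 => rfl
  | n + 1 => .inl ⟨1, one_mem_limitExhaustion n, 1, one_mem_limitExhaustion n, one_mul 1⟩

theorem limitExhaustion_mul_self_subset (n : ℕ) :
    limitExhaustion ι K n * limitExhaustion ι K n ⊆ limitExhaustion ι K (n + 1) :=
  Set.subset_union_left

theorem monotone_limitExhaustion : Monotone (limitExhaustion ι K) :=
  monotone_nat_of_le_succ fun n => (Set.subset_mul_left _ (one_mem_limitExhaustion n)).trans
    (limitExhaustion_mul_self_subset n)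

theorem image_subset_limitExhaustion {k n : ℕ} (h : k ≤ n) :
    ι k '' K k n ⊆ limitExhaustion ι K (n + 1) :=
  (Set.subset_biUnion_of_mem (u := fun k => ι k '' K k n)
    (Finset.mem_coe.2 (Finset.mem_range_succ_iff.2 h))).trans Set.subset_union_right

variable (hι : ∀ m n (h : m ≤ n) (a : A m), ι n (i m n h a) = ι m a)
  (hK : ∀ n, IsKOmegaExhaustionAt 1 (K n))

section

variable [∀ n, ContinuousMul (A n)]

include hι hK in
theorem exists_isCompact_image_eq_limitExhaustion (n : ℕ) :
    ∃ C : Set (A n), IsCompact C ∧ ι n '' C = limitExhaustion ι K n := by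
  induction n with
  | zero => exact ⟨{1}, isCompact_singleton, by simp [limitExhaustion]⟩
  | succ n ih =>
    obtain ⟨C, hC, hCB⟩ := ih
    obtain ⟨C', hC', hCC'⟩ := exists_isCompact_image_eq hι n.le_succ hC
    have h : ∀ k ∈ Finset.range (n + 1), ∃ D : Set (A (n + 1)), IsCompact D ∧
        ι (n + 1) '' D = ι k '' K k n := fun k hk =>
      exists_isCompact_image_eq hι (Finset.mem_range.1 hk).le ((hK k).isCompact n)
    choose! D hD hDK using h
    refine ⟨C' * C' ∪ ⋃ k ∈ Finset.range (n + 1), D k,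
      (hC'.mul hC').union (Finset.isCompact_biUnion _ hD), ?_⟩
    rw [Set.image_union, Set.image_mul, hCC', hCB, Set.image_iUnion₂, Set.iUnion₂_congr hDK]
    rfl

include hι hK in
theorem isCompact_limitExhaustion (n : ℕ) : IsCompact (limitExhaustion ι K n) := by
  obtain ⟨C, hC, hCB⟩ := exists_isCompact_image_eq_limitExhaustion hι hK n
  exact hCB ▸ hC.image (map_continuous _)

end

variable [∀ n, IsTopologicalGroup (A n)]

include hK in
theorem isOpen_preimage_of_forall_isOpen {O : Set X} (hO : O ⊆ ⋃ n, limitExhaustion ι K n)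
    (hOB : ∀ n, IsOpen ((↑) ⁻¹' O : Set (limitExhaustion ι K n))) (n : ℕ) :
    IsOpen (ι n ⁻¹' O) := by
  refine isOpen_iff_mem_nhds.2 fun x hx => ?_
  obtain ⟨k, hk⟩ := Set.mem_iUnion.1 (hO hx)
  have htranslate : ∀ᶠ u in 𝓝 (1 : A n), u ∈ ⋃ m, K n m ∧ ι n (x * u) ∈ O := by
    refine (hK n).eventually_of_forall_isOpen (by rwa [mul_one]) fun m => ?_
    let l := max k (max n m + 1)
    have hmem (u : K n m) : ι n (x * u) ∈ limitExhaustion ι K (l + 1) := by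
      rw [map_mul]
      refine limitExhaustion_mul_self_subset l (Set.mul_mem_mul
        (monotone_limitExhaustion (le_max_left _ _) hk)
        (monotone_limitExhaustion (le_max_right _ _)
          (image_subset_limitExhaustion (le_max_left n m) ⟨u, ?_, rfl⟩)))
      exact (hK n).monotone (le_max_right n m) u.2
    have hcont : Continuous fun u : K n m =>
        (⟨ι n (x * u), hmem u⟩ : limitExhaustion ι K (l + 1)) :=
      ((map_continuous (ι n)).comp (continuous_const.mul continuous_subtype_val)).subtype_mk _
    exact (hOB (l + 1)).preimage hcont
  have hx1 : Filter.Tendsto (x⁻¹ * ·) (𝓝 x) (𝓝 1) :=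
    (continuous_const_mul x⁻¹).tendsto' x 1 (inv_mul_cancel x)
  filter_upwards [hx1.eventually htranslate] with y hy
  simpa only [Set.mem_preimage, mul_inv_cancel_left] using hy.2

include hι hK in
theorem isKOmegaExhaustionAt_limitExhaustion
    (hfinal : ∀ O : Set X, (∀ n, IsOpen (ι n ⁻¹' O)) → IsOpen O) :
    IsKOmegaExhaustionAt 1 (limitExhaustion ι K) where
  monotone := monotone_limitExhaustion
  isCompact := isCompact_limitExhaustion hι hK
  mem := one_mem_limitExhaustion
  isOpen O hO hOB := hfinal O (isOpen_preimage_of_forall_isOpen hK hO hOB)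

end Limit

/-- The group `G`, equipped with the final topology with respect to a sequence of homomorphisms. -/
def WithFinalTopology {G : Type*} [CommGroup G] [TopologicalSpace G] (_ : ∀ n, A n →ₜ* G) :
    Type _ := G

namespace WithFinalTopology

variable {G : Type*} [CommGroup G] [TopologicalSpace G] {ι : ∀ n, A n →ₜ* G}

instance : CommGroup (WithFinalTopology ι) := inferInstanceAs (CommGroup G)

instance : TopologicalSpace (WithFinalTopology ι) :=
  ⨆ n, TopologicalSpace.coinduced (ι n) inferInstance

variable (ι) in
/-- The homomorphism `ι n`, with values in the group with the final topology. -/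
def of (n : ℕ) : A n →ₜ* WithFinalTopology ι where
  toMonoidHom := (ι n : A n →* G)
  continuous_toFun := continuous_iff_coinduced_le.2 (le_iSup (fun n =>
    TopologicalSpace.coinduced (ι n) inferInstance) n)

variable (ι) in
/-- The identity, as a continuous homomorphism to the given topology. -/
def toOriginal : WithFinalTopology ι →ₜ* G where
  toFun x := x
  map_one' := rfl
  map_mul' _ _ := rfl
  continuous_toFun := continuous_iSup_dom.2 fun n =>
    continuous_coinduced_dom.2 (map_continuous (ι n))

instance [T2Space G] : T2Space (WithFinalTopology ι) :=
  T2Space.of_injective_continuous (f := toOriginal ι) (fun _ _ h => h) (map_continuous _)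

theorem continuous_iff {Y : Type*} [TopologicalSpace Y] {f : WithFinalTopology ι → Y} :
    Continuous f ↔ ∀ n, Continuous (f ∘ of ι n) :=
  continuous_iSup_dom.trans (forall_congr' fun _ => continuous_coinduced_dom)

theorem isOpen_iff {O : Set (WithFinalTopology ι)} :
    IsOpen O ↔ ∀ n, IsOpen (of ι n ⁻¹' O) :=
  isOpen_iSup_iff.trans (forall_congr' fun _ => isOpen_coinduced)

theorem continuous_inv [∀ n, ContinuousInv (A n)] :
    Continuous fun x : WithFinalTopology ι => x⁻¹ :=
  continuous_iff.2 fun n => ((map_continuous (of ι n)).comp continuous_id.inv).congr fun a =>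
    map_inv (of ι n) a

variable (hι : ∀ m n (h : m ≤ n) (a : A m), ι n (i m n h a) = ι m a)
  (hsurj : ∀ g, ∃ n a, ι n a = g)

include hι hsurj in
theorem continuous_const_mul [∀ n, ContinuousMul (A n)] (x : WithFinalTopology ι) :
    Continuous fun y => x * y := by
  obtain ⟨m, b, rfl⟩ := hsurj x
  refine continuous_iff.2 fun n => ?_
  let l := max m n
  have hcont : Continuous fun a =>
      of ι l (i m l (le_max_left m n) b * i n l (le_max_right m n) a) :=
    (map_continuous (of ι l)).comp (continuous_const.mul (map_continuous _))
  refine hcont.congr fun a => (map_mul (of ι l) _ _).trans ?_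
  exact congrArg₂ (· * ·) (hι m l _ b) (hι n l _ a)

variable [∀ n, IsTopologicalGroup (A n)] [IsTopologicalGroup G] [T2Space G]

include hι in
theorem continuousAt_mul {K : ∀ n, ℕ → Set (A n)} (hK : ∀ n, IsKOmegaExhaustionAt 1 (K n)) :
    ContinuousAt (fun p : WithFinalTopology ι × WithFinalTopology ι => p.1 * p.2) (1, 1) := by
  have hB : IsKOmegaExhaustionAt 1 (limitExhaustion (of ι) K) :=
    isKOmegaExhaustionAt_limitExhaustion hι hK fun _ => isOpen_iff.2
  refine (hB.prod hB).continuousAt fun n =>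
    continuousOn_of_injective_of_isCompact (map_continuous (toOriginal ι)) (fun _ _ h => h)
      (hB.isCompact (n + 1)) (fun p hp => limitExhaustion_mul_self_subset n
        (Set.mul_mem_mul hp.1 hp.2)) (Continuous.continuousOn ?_)
  exact ((map_continuous (toOriginal ι)).comp continuous_fst).mul
    ((map_continuous (toOriginal ι)).comp continuous_snd)

include hι hsurj in
theorem isTopologicalGroup {K : ∀ n, ℕ → Set (A n)} (hK : ∀ n, IsKOmegaExhaustionAt 1 (K n)) :
    IsTopologicalGroup (WithFinalTopology ι) := by
  refine .of_comm_of_nhds_one ?_ (continuous_inv.tendsto' 1 1 inv_one) fun x => ?_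
  · have hmul := continuousAt_mul hι hK
    rwa [ContinuousAt, nhds_prod_eq, mul_one] at hmul
  · let e : WithFinalTopology ι ≃ₜ WithFinalTopology ι :=
      { Equiv.mulLeft x with
        continuous_toFun := continuous_const_mul hι hsurj x
        continuous_invFun := continuous_const_mul hι hsurj x⁻¹ }
    exact (congrArg 𝓝 (mul_one x)).symm.trans (e.map_nhds_eq 1).symm

end WithFinalTopology

end DirectSequence

namespace IsHausdorffDirectLimit

variable {A : ℕ → Type u} [∀ n, CommGroup (A n)] [∀ n, TopologicalSpace (A n)]
  {i : ∀ m n, m ≤ n → (A m →ₜ* A n)} {G : Type u} [CommGroup G] [TopologicalSpace G]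
  {ι : ∀ n, A n →ₜ* G}

theorem apply_apply (hG : IsHausdorffDirectLimit i G ι) (m n : ℕ) (h : m ≤ n) (a : A m) :
    ι n (i m n h a) = ι m a :=
  DFunLike.congr_fun (hG.comp_eq m n h) a

theorem hom_ext (hG : IsHausdorffDirectLimit i G ι) {H : Type u} [CommGroup H]
    [TopologicalSpace H] [IsTopologicalGroup H] [T2Space H] {f g : G →ₜ* H}
    (h : ∀ n a, f (ι n a) = g (ι n a)) : f = g := by
  obtain ⟨φ, -, hφ⟩ := hG.existsUnique_desc H (fun n => g.comp (ι n)) fun m n hmn => by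
    ext a
    exact congrArg g (hG.apply_apply m n hmn a)
  exact (hφ f fun n => by ext a; exact h n a).trans (hφ g fun n => rfl).symm

/-- The union of the images of the groups `A n`, as a subgroup of the direct limit. -/
def rangeSubgroup (hG : IsHausdorffDirectLimit i G ι) : Subgroup G where
  carrier := {g | ∃ n a, ι n a = g}
  one_mem' := ⟨0, 1, map_one _⟩
  mul_mem' := by
    rintro - - ⟨m, a, rfl⟩ ⟨n, b, rfl⟩
    exact ⟨max m n, i m _ (le_max_left m n) a * i n _ (le_max_right m n) b, by
      rw [map_mul, hG.apply_apply, hG.apply_apply]⟩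
  inv_mem' := by
    rintro - ⟨m, a, rfl⟩
    exact ⟨m, a⁻¹, map_inv _ _⟩

theorem exists_apply_eq (hG : IsHausdorffDirectLimit i G ι) (g : G) : ∃ n a, ι n a = g := by
  have := hG.isTopologicalGroup
  have := hG.t2Space
  let D := hG.rangeSubgroup
  obtain ⟨φ, hφ, -⟩ := hG.existsUnique_desc D
    (fun n =>
      { toMonoidHom := (ι n : A n →* G).codRestrict D fun a => ⟨n, a, rfl⟩
        continuous_toFun := (map_continuous (ι n)).subtype_mk _ })
    fun m n h => by
      ext a
      exact hG.apply_apply m n h a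
  let inclusion : D →ₜ* G := ⟨D.subtype, continuous_subtype_val⟩
  have hid : inclusion.comp φ = ContinuousMonoidHom.id G := hG.hom_ext fun n a =>
    congrArg Subtype.val (DFunLike.congr_fun (hφ n) a)
  have hφg : (φ g : G) = g := DFunLike.congr_fun hid g
  exact hφg ▸ (φ g).2

variable [∀ n, IsTopologicalGroup (A n)] {K : ∀ n, ℕ → Set (A n)}

theorem isOpen_of_forall_isOpen_preimage (hG : IsHausdorffDirectLimit i G ι)
    (hK : ∀ n, IsKOmegaExhaustionAt 1 (K n)) {O : Set G} (hO : ∀ n, IsOpen (ι n ⁻¹' O)) :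
    IsOpen O := by
  have := hG.isTopologicalGroup
  have := hG.t2Space
  have := WithFinalTopology.isTopologicalGroup hG.apply_apply hG.exists_apply_eq hK
  obtain ⟨φ, hφ, -⟩ := hG.existsUnique_desc (WithFinalTopology ι) (WithFinalTopology.of ι)
    fun m n h => by
      ext a
      exact hG.apply_apply m n h a
  have hφ_id : ∀ g, φ g = g := fun g => by
    obtain ⟨n, a, rfl⟩ := hG.exists_apply_eq g
    exact DFunLike.congr_fun (hφ n) a
  have hO' : IsOpen (X := WithFinalTopology ι) O := WithFinalTopology.isOpen_iff.2 hO
  convert hO'.preimage (map_continuous φ) using 1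
  ext g
  exact Iff.of_eq (congrArg (· ∈ O) (hφ_id g).symm)

theorem isKOmegaExhaustionAt_limitExhaustion (hG : IsHausdorffDirectLimit i G ι)
    (hK : ∀ n, IsKOmegaExhaustionAt 1 (K n)) :
    IsKOmegaExhaustionAt 1 (limitExhaustion ι K) :=
  _root_.isKOmegaExhaustionAt_limitExhaustion hG.apply_apply hK fun _ =>
    hG.isOpen_of_forall_isOpen_preimage hK

theorem exists_mem_nhds_inter_subset_image (hG : IsHausdorffDirectLimit i G ι)
    (hK : ∀ n, IsKOmegaExhaustionAt 1 (K n)) {Z : Set G} (hZ : IsCompact Z) (g : G) :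
    ∃ N ∈ 𝓝 g, ∃ n, ∃ C : Set (A n), IsCompact C ∧ Z ∩ N ⊆ ι n '' C := by
  have := hG.isTopologicalGroup
  have := hG.t2Space
  have hB := hG.isKOmegaExhaustionAt_limitExhaustion hK
  have hdiv : Filter.Tendsto (g⁻¹ * ·) (𝓝 g) (𝓝 1) :=
    (continuous_const_mul g⁻¹).tendsto' g 1 (inv_mul_cancel g)
  obtain ⟨N, ⟨hN, hNclosed⟩, hNB⟩ :=
    (closed_nhds_basis g).mem_iff.1 (hdiv.eventually hB.iUnion_mem_nhds)
  obtain ⟨m, hm⟩ := hB.exists_subset_of_isCompact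
    ((hZ.inter_right hNclosed).image (continuous_const_mul g⁻¹))
    (Set.image_subset_iff.2 fun x hx => hNB hx.2)
  obtain ⟨C, hC, hCB⟩ := exists_isCompact_image_eq_limitExhaustion hG.apply_apply hK m
  obtain ⟨k, a, rfl⟩ := hG.exists_apply_eq g
  obtain ⟨D, hD, hDC⟩ := exists_isCompact_image_eq hG.apply_apply (le_max_left m k) hC
  refine ⟨N, hN, max m k, (i k _ (le_max_right m k) a * ·) '' D,
    hD.image (continuous_const_mul _), fun x hx => ?_⟩
  obtain ⟨d, hd, hdx⟩ := (hDC.trans hCB).ge (hm ⟨x, hx, rfl⟩)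
  exact ⟨_, ⟨d, hd, rfl⟩, by simp only [map_mul, hG.apply_apply, hdx, mul_inv_cancel_left]⟩

theorem exists_isCompact_subset_image (hG : IsHausdorffDirectLimit i G ι)
    (hK : ∀ n, IsKOmegaExhaustionAt 1 (K n)) {Z : Set G} (hZ : IsCompact Z) :
    ∃ n, ∃ C : Set (A n), IsCompact C ∧ Z ⊆ ι n '' C := by
  refine hZ.induction_on (p := fun Y => ∃ n, ∃ C : Set (A n), IsCompact C ∧ Y ⊆ ι n '' C)
    ⟨0, ∅, isCompact_empty, Set.empty_subset _⟩
    (fun Y Y' hYY' ⟨n, C, hC, hYC⟩ => ⟨n, C, hC, hYY'.trans hYC⟩) ?_ fun g _ => ?_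
  · rintro Y Y' ⟨m, C, hC, hYC⟩ ⟨n, C', hC', hYC'⟩
    obtain ⟨D, hD, hDC⟩ := exists_isCompact_image_eq hG.apply_apply (le_max_left m n) hC
    obtain ⟨D', hD', hDC'⟩ := exists_isCompact_image_eq hG.apply_apply (le_max_right m n) hC'
    refine ⟨max m n, D ∪ D', hD.union hD', ?_⟩
    rw [Set.image_union, hDC, hDC']
    exact Set.union_subset_union hYC hYC'
  · obtain ⟨N, hN, hlift⟩ := hG.exists_mem_nhds_inter_subset_image hK hZ g
    exact ⟨Z ∩ N, Filter.inter_mem self_mem_nhdsWithin (mem_nhdsWithin_of_mem_nhds hN), hlift⟩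

end IsHausdorffDirectLimit

/-! ### Extension of characters -/

section Extension

theorem exists_hom_apply_eq_of_isDenseInducing {X Y T : Type*} [CommGroup X] [TopologicalSpace X]
    [IsTopologicalGroup X] [CommGroup Y] [TopologicalSpace Y] [IsTopologicalGroup Y] [CommGroup T]
    [UniformSpace T] [IsUniformGroup T] [CompleteSpace T] [T2Space T] {f : X →* Y}
    (hf : IsDenseInducing f) (χ : X →ₜ* T) : ∃ χ' : Y →ₜ* T, ∀ x, χ' (f x) = χ x := by
  let := IsTopologicalGroup.rightUniformSpace X
  let := IsTopologicalGroup.rightUniformSpace Y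
  have := isUniformGroup_of_commGroup (G := X)
  have := isUniformGroup_of_commGroup (G := Y)
  have hf' : IsUniformInducing f := MonoidHom.isUniformInducing_of_isInducing hf.isInducing
  have hχ : UniformContinuous χ := uniformContinuous_monoidHom_of_continuous (map_continuous χ)
  have hcont : Continuous (hf.extend χ) :=
    (uniformContinuous_uniformly_extend hf' hf.dense hχ).continuous
  have hext : ∀ x, hf.extend χ (f x) = χ x := hf.extend_eq (map_continuous χ)
  refine ⟨⟨⟨⟨hf.extend χ, ?_⟩, fun y z => ?_⟩, hcont⟩, hext⟩
  · rw [← map_one f, hext, map_one]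
  · refine hf.dense.induction_on₂
      (p := fun y z => hf.extend χ (y * z) = hf.extend χ y * hf.extend χ z)
      (isClosed_eq (by fun_prop) (by fun_prop)) (fun a b => ?_) y z
    rw [← map_mul, hext, hext, hext, map_mul]

theorem exists_character_apply_eq_of_denseRange {X Y : Type*} [CommGroup X] [CommGroup Y]
    [TopologicalSpace Y] [IsTopologicalGroup Y] {f : X →* Y} (hf : DenseRange f)
    (χ : X →* Circle) {V : Set Y} (hV : V ∈ 𝓝 1) (hχ : ∀ x, f x ∈ V → 0 ≤ (χ x : ℂ).re) :
    ∃ χ' : PontryaginDual Y, ∀ x, χ' (f x) = χ x := by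
  let := TopologicalSpace.induced f inferInstance
  have := topologicalGroup_induced f
  have hV' : f ⁻¹' V ∈ 𝓝 (1 : X) := continuous_induced_dom.continuousAt (by rwa [map_one])
  have hcont : Continuous χ := continuous_of_continuousAt_one χ fun W hW => by
    obtain ⟨V', hV', hVW⟩ := exists_mem_nhds_one_forall_hom_mem hV' (by rwa [map_one] at hW)
    exact Filter.mem_map.2 (Filter.mem_of_superset hV' fun x hx => hVW χ hχ x hx)
  exact exists_hom_apply_eq_of_isDenseInducing ⟨⟨rfl⟩, hf⟩ ⟨χ, hcont⟩

theorem surjective_map_of_isDuallyEmbedded {A B : Type*} [CommGroup A] [TopologicalSpace A]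
    [CommGroup B] [TopologicalSpace B] {f : A →ₜ* B} (hf : IsEmbedding f)
    (hd : IsDuallyEmbedded (f : A →* B).range) : Function.Surjective (PontryaginDual.map f) := by
  intro ξ
  let e := MonoidHom.ofInjective (f := (f : A →* B)) hf.injective
  have he : f ∘ e.symm = Subtype.val := funext fun y => congrArg Subtype.val (e.apply_symm_apply y)
  have hcont : Continuous e.symm :=
    hf.isInducing.continuous_iff.2 (he ▸ continuous_subtype_val)
  obtain ⟨θ, hθ⟩ := hd (ContinuousMonoidHom.comp ξ ⟨e.symm.toMonoidHom, hcont⟩)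
  refine ⟨θ, ?_⟩
  ext a : 1
  exact (hθ (e a)).trans (congrArg ξ (e.symm_apply_apply a))

end Extension

/-! ### The dual of a direct limit -/

section InverseSequence

variable {B : ℕ → Type*} {p : ∀ m n, m ≤ n → B n → B m}
  (hp_self : ∀ n b, p n n le_rfl b = b)
  (hp_comp : ∀ k m n (hkm : k ≤ m) (hmn : m ≤ n) b,
    p k m hkm (p m n hmn b) = p k n (hkm.trans hmn) b)

include hp_self hp_comp in
theorem exists_compatible_of_surjective_succ
    (hsurj : ∀ n, Function.Surjective (p n (n + 1) n.le_succ)) (n : ℕ) (b : B n) :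
    ∃ c : ∀ m, B m, (∀ k m (h : k ≤ m), p k m h (c m) = c k) ∧ c n = b := by
  choose lift hlift using hsurj
  let d (k : ℕ) : B (n + k) := Nat.rec b (fun k => lift (n + k)) k
  have hd : ∀ k l (h : k ≤ l), p (n + k) (n + l) (Nat.add_le_add_left h n) (d l) = d k := by
    intro k l h
    induction l, h using Nat.le_induction with
    | base => exact hp_self _ _
    | succ l h ih => rw [← ih, ← hlift (n + l) (d l), hp_comp]; rfl
  refine ⟨fun m => p m (n + m) (Nat.le_add_left m n) (d m), fun k m h => ?_, ?_⟩
  · dsimp only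
    rw [← hd k m h, hp_comp, hp_comp]
  · exact hd 0 n n.zero_le

end InverseSequence

namespace IsHausdorffDirectLimit

variable {A : ℕ → Type u} [∀ n, CommGroup (A n)] [∀ n, TopologicalSpace (A n)]
  {i : ∀ m n, m ≤ n → (A m →ₜ* A n)} {G : Type u} [CommGroup G] [TopologicalSpace G]
  {ι : ∀ n, A n →ₜ* G}

theorem exists_map_eq (hG : IsHausdorffDirectLimit i G ι) (b : ∀ n, PontryaginDual (A n))
    (hb : ∀ m n (h : m ≤ n), PontryaginDual.map (i m n h) (b n) = b m) :
    ∃ ξ : PontryaginDual G, ∀ n, PontryaginDual.map (ι n) ξ = b n := by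
  let up : Circle →ₜ* ULift.{u} Circle :=
    ⟨⟨⟨ULift.up, rfl⟩, fun _ _ => rfl⟩, continuous_uliftUp⟩
  let down : ULift.{u} Circle →ₜ* Circle :=
    ⟨⟨⟨ULift.down, rfl⟩, fun _ _ => rfl⟩, continuous_uliftDown⟩
  obtain ⟨φ, hφ, -⟩ := hG.existsUnique_desc (ULift.{u} Circle) (fun n => up.comp (b n))
    fun m n h => by
      ext a : 1
      exact congrArg up (DFunLike.congr_fun (hb m n h) a)
  refine ⟨down.comp φ, fun n => ?_⟩
  ext a : 1
  exact congrArg down (DFunLike.congr_fun (hφ n) a)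

theorem dual_ext (hG : IsHausdorffDirectLimit i G ι) {ξ θ : PontryaginDual G}
    (h : ∀ n, PontryaginDual.map (ι n) ξ = PontryaginDual.map (ι n) θ) : ξ = θ := by
  ext g : 1
  obtain ⟨n, a, rfl⟩ := hG.exists_apply_eq g
  exact DFunLike.congr_fun (h n) a

theorem surjective_map (hG : IsHausdorffDirectLimit i G ι)
    [DirectedSystem A (fun m n h => i m n h)]
    (hsurj : ∀ n, Function.Surjective (PontryaginDual.map (i n (n + 1) n.le_succ))) (n : ℕ) :
    Function.Surjective (PontryaginDual.map (ι n)) := by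
  intro ξ
  obtain ⟨b, hb, rfl⟩ := exists_compatible_of_surjective_succ
    (p := fun m n h => PontryaginDual.map (i m n h))
    (fun n θ => by
      ext a : 1
      exact congrArg θ (DirectedSystem.map_self' (f := fun m n h => i m n h) a))
    (fun k m n hkm hmn θ => by
      ext a : 1
      exact congrArg θ (DirectedSystem.map_map' (f := fun m n h => i m n h) hkm hmn a))
    hsurj n ξ
  obtain ⟨θ, hθ⟩ := hG.exists_map_eq b hb
  exact ⟨θ, hθ n⟩

theorem map_mem_projectiveLimit (hG : IsHausdorffDirectLimit i G ι) (ξ : PontryaginDual G) :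
    (fun n => PontryaginDual.map (ι n) ξ) ∈ projectiveLimit (fun n => PontryaginDual (A n))
      (fun m n h => PontryaginDual.map (i m n h)) := fun m n h => by
  ext a : 1
  exact congrArg ξ (hG.apply_apply m n h a)

/-- The isomorphism `ξ ↦ (ξ ∘ ι n)ₙ` of groups from the dual of the direct limit to the projective
limit of the duals. -/
noncomputable def dualMulEquiv (hG : IsHausdorffDirectLimit i G ι) :
    PontryaginDual G ≃* projectiveLimit (fun n => PontryaginDual (A n))
      (fun m n h => PontryaginDual.map (i m n h)) :=
  MulEquiv.ofBijective
    ({ toFun := fun ξ => ⟨_, hG.map_mem_projectiveLimit ξ⟩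
       map_one' := rfl
       map_mul' := fun _ _ => rfl } : PontryaginDual G →* _)
    ⟨fun _ _ h => hG.dual_ext fun n => congrFun (congrArg Subtype.val h) n, fun b =>
      (hG.exists_map_eq b.1 b.2).imp fun _ hξ => Subtype.ext (funext hξ)⟩

variable [∀ n, IsTopologicalGroup (A n)] {K : ∀ n, ℕ → Set (A n)}

theorem exists_isCompact_preimage_polar_subset (hG : IsHausdorffDirectLimit i G ι)
    (hK : ∀ n, IsKOmegaExhaustionAt 1 (K n)) {W : Set (PontryaginDual G)} (hW : W ∈ 𝓝 1) :
    ∃ n, ∃ C : Set (A n), IsCompact C ∧ PontryaginDual.map (ι n) ⁻¹' polar C ⊆ W := by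
  have := hG.isTopologicalGroup
  obtain ⟨Z, hZ, hZW⟩ := exists_isCompact_polar_subset hW
  obtain ⟨n, C, hC, hZC⟩ := hG.exists_isCompact_subset_image hK hZ
  exact ⟨n, C, hC, polar_image (ι n) C ▸ (polar_anti hZC).trans hZW⟩

theorem continuous_dualMulEquiv_symm (hG : IsHausdorffDirectLimit i G ι)
    (hK : ∀ n, IsKOmegaExhaustionAt 1 (K n)) : Continuous hG.dualMulEquiv.symm := by
  have := hG.isTopologicalGroup
  refine continuous_of_continuousAt_one _ fun W hW => ?_
  rw [map_one] at hW
  obtain ⟨n, C, hC, hCW⟩ := hG.exists_isCompact_preimage_polar_subset hK hW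
  have hcoord : Continuous fun b : projectiveLimit (fun n => PontryaginDual (A n))
      (fun m n h => PontryaginDual.map (i m n h)) => (b : ∀ n, PontryaginDual (A n)) n :=
    (continuous_apply n).comp continuous_subtype_val
  have hcoordC : ∀ᶠ b : projectiveLimit (fun n => PontryaginDual (A n))
      (fun m n h => PontryaginDual.map (i m n h)) in 𝓝 1,
      (b : ∀ n, PontryaginDual (A n)) n ∈ polar C :=
    hcoord.continuousAt (polar_mem_nhds_one hC)
  refine Filter.mem_map.2 (hcoordC.mono fun b hb => ?_)
  obtain ⟨ξ, rfl⟩ := hG.dualMulEquiv.surjective b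
  exact (hG.dualMulEquiv.symm_apply_apply ξ).symm ▸ hCW hb

/-- The isomorphism `ξ ↦ (ξ ∘ ι n)ₙ` of topological groups from the dual of the direct limit to the
projective limit of the duals. -/
noncomputable def dualContinuousMulEquiv (hG : IsHausdorffDirectLimit i G ι)
    (hK : ∀ n, IsKOmegaExhaustionAt 1 (K n)) :
    PontryaginDual G ≃ₜ* projectiveLimit (fun n => PontryaginDual (A n))
      (fun m n h => PontryaginDual.map (i m n h)) where
  toMulEquiv := hG.dualMulEquiv
  continuous_toFun := Continuous.subtype_mk (continuous_pi fun n =>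
    map_continuous (PontryaginDual.map (ι n))) _
  continuous_invFun := hG.continuous_dualMulEquiv_symm hK

theorem surjective_dualEval (hG : IsHausdorffDirectLimit i G ι)
    (hK : ∀ n, IsKOmegaExhaustionAt 1 (K n)) (hη : ∀ n, Function.Surjective (dualEval (A n)))
    (hdense : ∀ n, DenseRange (PontryaginDual.map (ι n))) : Function.Surjective (dualEval G) := by
  intro χ
  have hW : {ξ : PontryaginDual G | 0 < (χ ξ : ℂ).re} ∈ 𝓝 1 :=
    (isOpen_lt continuous_const (continuous_circle_re.comp (map_continuous χ))).mem_nhds (by simp)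
  obtain ⟨n, C, hC, hCW⟩ := hG.exists_isCompact_preimage_polar_subset hK hW
  obtain ⟨χ', hχ'⟩ := exists_character_apply_eq_of_denseRange
    (f := (PontryaginDual.map (ι n) : PontryaginDual G →* PontryaginDual (A n))) (hdense n)
    (ContinuousMonoidHom.toMonoidHom χ) (polar_mem_nhds_one hC) fun ξ hξ => (hCW hξ).le
  obtain ⟨x, rfl⟩ := hη n χ'
  refine ⟨ι n x, ?_⟩
  ext ξ : 1
  exact hχ' ξ

end IsHausdorffDirectLimit

theorem mainTheorem11_general
    (A : ℕ → Type u) [∀ n, CommGroup (A n)] [∀ n, TopologicalSpace (A n)]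
    [∀ n, IsTopologicalGroup (A n)] (hA : ∀ n, ∃ K, IsKOmegaExhaustionAt (1 : A n) K)
    (i : ∀ m n, m ≤ n → (A m →ₜ* A n)) [DirectedSystem A (fun m n h => i m n h)]
    (G : Type u) [CommGroup G] [TopologicalSpace G]
    (ι : ∀ n, A n →ₜ* G) (hG : IsHausdorffDirectLimit i G ι) :
    (∃ e : PontryaginDual G ≃ₜ* projectiveLimit (fun n => PontryaginDual (A n))
        (fun m n h => PontryaginDual.map (i m n h)),
      ∀ (ξ : PontryaginDual G) (n : ℕ),
        (e ξ : ∀ n, PontryaginDual (A n)) n = PontryaginDual.map (ι n) ξ) ∧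
    ((∀ n, Function.Surjective (dualEval (A n))) →
      (∀ n, DenseRange (PontryaginDual.map (ι n))) →
      IsReflexive (Lqc G) ∧ IsHomeomorph (PontryaginDual.map (toLqc G))) ∧
    ((∀ n, Function.Surjective (PontryaginDual.map (i n (n + 1) n.le_succ))) →
      ∀ n, Function.Surjective (PontryaginDual.map (ι n))) := by
  choose K hK using hA
  have := hG.isTopologicalGroup
  have hB := hG.isKOmegaExhaustionAt_limitExhaustion hK
  have := hB.compactlyCoherentSpace
  have := hB.compactlyCoherentSpace_pontryaginDual
  exact ⟨⟨hG.dualContinuousMulEquiv hK, fun _ _ => rfl⟩,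
    fun hη hdense => isReflexive_lqc_and_isHomeomorph_map_toLqc continuous_dualEval
      continuous_dualEval (hG.surjective_dualEval hK hη hdense),
    hG.surjective_map⟩

theorem mainTheorem11
    (A : ℕ → Type u) [∀ n, CommGroup (A n)] [∀ n, TopologicalSpace (A n)]
    [∀ n, IsTopologicalGroup (A n)] (hA : ∀ n, IsLocallyKOmegaSpace (A n))
    (i : ∀ m n, m ≤ n → (A m →ₜ* A n)) [DirectedSystem A (fun m n h => i m n h)]
    (G : Type u) [CommGroup G] [TopologicalSpace G] [IsTopologicalGroup G]
    (ι : ∀ n, A n →ₜ* G) (hG : IsHausdorffDirectLimit i G ι) :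
    (∃ e : PontryaginDual G ≃ₜ* projectiveLimit (fun n => PontryaginDual (A n))
        (fun m n h => PontryaginDual.map (i m n h)),
      ∀ (ξ : PontryaginDual G) (n : ℕ),
        (e ξ : ∀ n, PontryaginDual (A n)) n = PontryaginDual.map (ι n) ξ) ∧
    ((∀ n, IsReflexive (A n)) → (∀ n, DenseRange (PontryaginDual.map (ι n))) →
      IsReflexive (Lqc G) ∧ IsHomeomorph (PontryaginDual.map (toLqc G))) ∧
    ((∀ m n (h : m ≤ n), IsEmbedding (i m n h)) →
      (∀ m n (h : m ≤ n), IsDuallyEmbedded (i m n h : A m →* A n).range) →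
      ∀ n, DenseRange (PontryaginDual.map (ι n))) := by
  obtain ⟨hdual, hreflexive, hsurjective⟩ :=
    mainTheorem11_general A (fun n => (hA n).exists_isKOmegaExhaustionAt 1) i G ι hG
  exact ⟨hdual, fun hr => hreflexive fun n => (hr n).surjective, fun he hd n =>
    (hsurjective (fun m => surjective_map_of_isDuallyEmbedded (he m _ _) (hd m _ _)) n).denseRange⟩
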